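/- **Model.** Let $N\in\mathbb N$ and let $\Pi\subset\mathbb Z_+^N$ be a finite schedule set such that (i) $\Pi$ is monotone: if $d\in\Pi$, $d'\in\mathbb Z_+^N$ and $d'\le d$ coordinatewise, then $d'\in\Pi$; (ii) there is $c>0$ with $c\,e^{(i)}\in\Pi$ for every $i$; (iii) $\Pi$ has at least two distinct maximal elements. A channel is a triple $\mathcal C=(\mathcal X,\mathcal Y,C)$ with $\mathcal X,\mathcal Y$ finite and $C$ a row-stochastic $\mathcal X\times\mathcal Y$ matrix. For $\varepsilon\in(0,1)$ it is *$\varepsilon$-majorizing* if $C=\varepsilon C^0+(1-\varepsilon)C^1$ with $C^0,C^1$ row stochastic, all rows of $C^0$ identical, and every column of $C^1$ containing a zero entry. Queues $Q(t)\in\mathbb Z_+^N$ evolve by $Q(t)=(Q(t-1)-D(t))^++A(t)$, where the $A_i(t)$ are independent Bernoulli variables with means $\lambda_i\in[0,1]$. The encoder has $k$ bits of memory and the receiver has $v$ bits. An encoding policy $\phi\in\Phi_k$ and an allocation policy $\psi=(\psi_a,\psi_m)\in\Psi_v$ are measurable functions with $$(X(t),M_e(t))=\phi(Q(t-1),A(t-1),M_e(t-1),M_r(t-1),U_e(t-1)),$$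 $$D(t)=\psi_a(Y(t),M_r(t-1),U_r(t-1))\in\Pi,\qquad M_r(t)=\psi_m(Y(t-1),M_r(t-1),U_r(t-1)),$$ where the $U_e(t),U_r(t)$ are independent uniform variables on the unit interval, independent of everything else, and $Y(t)$ is drawn from row $X(t)$ of $C$. The pair $(\phi,\psi)$ *stabilizes* $\lambda\in[0,1]^N$ if the Markov chain $(Q,A,M_e,X,Y,M_r)$ is positive recurrent, i.e. has a state which is reached in finite mean time from every initial state. Let $\tilde\Lambda(\phi,\psi)$ be the set of stabilized $\lambda$, let $\Lambda=\{\lambda\in\mathbb R_+^N:\ \lambda_i<z_i\ \forall i \text{ for some } z\in\mathrm{conv}(\Pi)\}$, and define $$\rho^*(\phi,\psi,\mathcal C)=\sup\{\rho\ge 0:\rho\Lambda\subseteq\tilde\Lambda(\phi,\psi)\},\qquad \rho^*_{k,v}(\mathcal C)=\sup_{\phi\in\Phi_k,\ \psi\in\Psi_v}\rho^*(\phi,\psi,\mathcal C),\qquad \rho^*_{\infty,v}(\mathcal C)=\lim_{k\to\infty}\rho^*_{k,v}(\mathcal C)$$ (with $\sup\emptyset=0$). **Theorem.** For every such $\Pi$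 and every $\varepsilon\in(0,1)$ there is a constant $\rho(\varepsilon,\Pi)<1$, depending only on $\varepsilon$ and $\Pi$, such that: 1. for every $\varepsilon$-majorizing channel $\mathcal C$, $\rho^*_{k,0}(\mathcal C)\le\rho(\varepsilon,\Pi)$ for all integers $k\ge0$, and the limit $\rho^*_{\infty,0}(\mathcal C)$ exists and is also at most $\rho(\varepsilon,\Pi)$; 2. conversely, there exists an $\varepsilon$-majorizing channel $\mathcal C$ with $\rho^*_{0,0}(\mathcal C)=\rho(\varepsilon,\Pi)$. -/

import Mathlib

open scoped ENNReal NNReal Topology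
open Filter MeasureTheory

namespace SPII

/-- A channel with input alphabet `X` and output alphabet `Y`: a row-stochastic matrix. -/
structure Channel (X Y : Type) [Fintype Y] where
  matrix : Matrix X Y ℝ
  nonneg : ∀ x y, 0 ≤ matrix x y
  row_sum : ∀ x, ∑ y, matrix x y = 1

/-- `C = ε C⁰ + (1 - ε) C¹` with `C⁰`, `C¹` row stochastic, all rows of `C⁰` equal, and every
column of `C¹` containing a zero entry. -/
def Channel.IsMajorizing {X Y : Type} [Fintype Y] (C : Channel X Y) (ε : ℝ) : Prop :=
  ∃ C₀ C₁ : Channel X Y,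
    C.matrix = ε • C₀.matrix + (1 - ε) • C₁.matrix ∧
    (∀ x x' y, C₀.matrix x y = C₀.matrix x' y) ∧
    (∀ y, ∃ x, C₁.matrix x y = 0)

/-- The standing assumptions on a finite schedule set `S ⊆ ℤ₊ᴺ`. -/
structure IsScheduleSet {N : ℕ} (S : Finset (Fin N → ℕ)) : Prop where
  monotone : ∀ d ∈ S, ∀ d' : Fin N → ℕ, d' ≤ d → d' ∈ S
  serves_each : ∃ c : ℕ, 0 < c ∧ ∀ i : Fin N, Pi.single i c ∈ S
  two_maximal : ∃ d₁ d₂ : Fin N → ℕ, d₁ ≠ d₂ ∧ Maximal (· ∈ S) d₁ ∧ Maximal (· ∈ S) d₂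

/-- The convex hull of the schedule set in `ℝᴺ`. -/
def scheduleHull {N : ℕ} (S : Finset (Fin N → ℕ)) : Set (Fin N → ℝ) :=
  convexHull ℝ ((fun d : Fin N → ℕ => fun i => (d i : ℝ)) '' (S : Set (Fin N → ℕ)))

/-- The maximum capacity region: nonnegative vectors strictly dominated, in every coordinate, by a
point of the convex hull of the schedule set. -/
def maxCapacityRegion {N : ℕ} (S : Finset (Fin N → ℕ)) : Set (Fin N → ℝ) :=
  {lam | (∀ i, 0 ≤ lam i) ∧ ∃ z ∈ scheduleHull S, ∀ i, lam i < z i}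

/-- The contents of a memory of `k` bits. -/
abbrev Memory (k : ℕ) : Type := Fin k → Bool

/-- An encoding policy with `k` bits of memory for a system with memory-feedback:
`(X(t), M_e(t)) = φ(Q(t-1), A(t-1), M_e(t-1), M_r(t-1), U_e(t-1))`,
where `U_e(t-1)` is uniform on the unit interval. -/
structure EncodingPolicy (N : ℕ) (X : Type) (k v : ℕ) where
  toFun : (Fin N → ℕ) → (Fin N → Bool) → Memory k → Memory v → unitInterval → X × Memory k
  measurable : ∀ q a m r p, MeasurableSet {u | toFun q a m r u = p}

/-- An allocation policy with `v` bits of memory: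
`D(t) = ψ_a(Y(t), M_r(t-1), U_r(t-1))` (always an element of the schedule set) and
`M_r(t) = ψ_m(Y(t-1), M_r(t-1), U_r(t-1))`, where `U_r(t-1)` is uniform on the unit interval. -/
structure AllocationPolicy {N : ℕ} (S : Finset (Fin N → ℕ)) (Y : Type) (v : ℕ) where
  allocate : Y → Memory v → unitInterval → (Fin N → ℕ)
  update : Y → Memory v → unitInterval → Memory v
  allocate_mem : ∀ y r u, allocate y r u ∈ S
  measurable_allocate : ∀ y r d, MeasurableSet {u | allocate y r u = d}
  measurable_update : ∀ y r r', MeasurableSet {u | update y r u = r'}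

/-- The system state `(Q(t), A(t), M_e(t), X(t), Y(t), M_r(t))`. The message `Y(t)` is recorded
because the next receiver memory `M_r(t+1)` is a function of it. -/
structure State (N : ℕ) (X Y : Type) (k v : ℕ) where
  queue : Fin N → ℕ
  arrival : Fin N → Bool
  encMem : Memory k
  signal : X
  message : Y
  recMem : Memory v

/-- The probability that independent Bernoulli arrivals with means `lam i` equal `a`. -/
noncomputable def arrivalProb {N : ℕ} (lam : Fin N → ℝ) (a : Fin N → Bool) : ℝ≥0∞ :=
  ∏ i, if a i then ENNReal.ofReal (lam i) else ENNReal.ofReal (1 - lam i)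

/-- The one-step transition probabilities of the system state. The factors are the probabilities
of: the signal and encoder memory produced by the encoder; the message given the signal; the
arrivals; and the receiver randomness leading to the new queues
`Q(t) = (Q(t-1) - D(t))⁺ + A(t)` and the new receiver memory. (Subtraction of natural numbers is
truncated at zero.) -/
noncomputable def transition {N : ℕ} {S : Finset (Fin N → ℕ)} {X Y : Type} [Fintype Y] {k v : ℕ}
    (C : Channel X Y) (φ : EncodingPolicy N X k v) (ψ : AllocationPolicy S Y v)
    (lam : Fin N → ℝ) (w w' : State N X Y k v) : ℝ≥0∞ :=
  volume {u : unitInterval |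
      φ.toFun w.queue w.arrival w.encMem w.recMem u = (w'.signal, w'.encMem)} *
    ENNReal.ofReal (C.matrix w'.signal w'.message) *
    arrivalProb lam w'.arrival *
    volume {u : unitInterval |
      (∀ i, w'.queue i =
        (w.queue i - ψ.allocate w'.message w.recMem u i) + (w'.arrival i).toNat) ∧
      w'.recMem = ψ.update w.message w.recMem u}

/-- For a Markov chain with transition probabilities `P`, the probability, started from `w`, that
`w₀` is not visited at any of the times `1, …, n`. -/
noncomputable def avoidProb {W : Type} (P : W → W → ℝ≥0∞) (w₀ : W) : ℕ → W → ℝ≥0∞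
  | 0, _ => 1
  | n + 1, w => ∑' w' : {w' : W // w' ≠ w₀}, P w w' * avoidProb P w₀ n w'

/-- The expectation, started from `w`, of the first time `t ≥ 1` at which the chain is at `w₀`
(as the sum over `n ≥ 0` of the probability that this time exceeds `n`). -/
noncomputable def meanHittingTime {W : Type} (P : W → W → ℝ≥0∞) (w₀ w : W) : ℝ≥0∞ :=
  ∑' n, avoidProb P w₀ n w

/-- Positive recurrence, up to transient states: some state is reached in finite mean time from
every initial state (itself included). For a chain which is irreducible on its whole state space
this is the usual positive recurrence; in general it says that there is exactly one closed
communicating class, that this class is positive recurrent, and that it is entered in finite mean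
time from everywhere. -/
def IsPositiveRecurrent {W : Type} (P : W → W → ℝ≥0∞) : Prop :=
  ∃ w₀, ∀ w, meanHittingTime P w₀ w < ∞

/-- The capacity region of a policy pair: the Bernoulli arrival rate vectors under which it
stabilizes the system. -/
def capacityRegion {N : ℕ} {S : Finset (Fin N → ℕ)} {X Y : Type} [Fintype Y] {k v : ℕ}
    (C : Channel X Y) (φ : EncodingPolicy N X k v) (ψ : AllocationPolicy S Y v) :
    Set (Fin N → ℝ) :=
  {lam | (∀ i, 0 ≤ lam i ∧ lam i ≤ 1) ∧ IsPositiveRecurrent (transition C φ ψ lam)}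

/-- The capacity factor of a channel under a policy pair. -/
noncomputable def policyCapacityFactor {N : ℕ} {S : Finset (Fin N → ℕ)} {X Y : Type} [Fintype Y]
    {k v : ℕ} (C : Channel X Y) (φ : EncodingPolicy N X k v) (ψ : AllocationPolicy S Y v) :
    ℝ≥0∞ :=
  ⨆ (r : ℝ≥0) (_ : ∀ lam ∈ maxCapacityRegion S, (r : ℝ) • lam ∈ capacityRegion C φ ψ), (r : ℝ≥0∞)

/-- The `(k, v)`-capacity factor of a channel. -/
noncomputable def capacityFactor {N : ℕ} (S : Finset (Fin N → ℕ)) {X Y : Type} [Fintype Y]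
    (C : Channel X Y) (k v : ℕ) : ℝ≥0∞ :=
  ⨆ (φ : EncodingPolicy N X k v) (ψ : AllocationPolicy S Y v), policyCapacityFactor C φ ψ

end SPII

/-! Write `h` for the support function `maxWeight` of the schedule set. A receiver without memory
cannot tell the two components of a majorizing channel apart. On the uninformative component, of
weight `ε`, its mean schedule is a fixed point `m` of the hull, whatever the encoder does; on the
other component the service in a direction `w ≥ 0` is at most `h w`. Hence the mean service along
`w` never exceeds `(1 - ε) h w + ε ⟨w, m⟩`. If `⟨w, λ⟩` exceeded it, the linear function `⟨w, Q⟩`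
would have uniformly positive drift, which excludes positive recurrence. Letting `λ` approach `r`
times a schedule attaining `h w` shows that a supported fraction `r` lies, with `m`, in
`feasibleSet`; the constraints `r * d i ≤ 1` are there because Bernoulli rates are at most one.

The constant `ρ` is the largest `r` in this compact set, so it depends on `ε` and the schedule set
alone. It is below one because `m` cannot dominate every schedule when there are two maximal ones.

For the converse, take an optimal `m` and a law on schedules with mean `m`. The channel delivers the
schedule it is given with probability `1 - ε` and otherwise draws one from this law. Under
max-weight encoding and an obedient receiver the service bound is attained with equality for `w`
proportional to the queues, so the quadratic Lyapunov function has negative drift throughout `ρ Λ`.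
-/

namespace SPII

/-! ### Hitting times of Markov chains with finitely many moves per state -/

open Classical in
/-- The transition probabilities `P` are finite mixtures: from `w` the chain moves to `t w i` with
probability `c w i`. -/
structure IsFiniteMixture {W I : Type} [Fintype I] (P : W → W → ℝ≥0∞) (c : W → I → ℝ)
    (t : W → I → W) : Prop where
  nonneg : ∀ w i, 0 ≤ c w i
  sum_eq_one : ∀ w, ∑ i, c w i = 1
  eq_sum : ∀ w w', P w w' = ∑ i with t w i = w', ENNReal.ofReal (c w i)

namespace IsFiniteMixture

variable {W I : Type} [Fintype I] {P : W → W → ℝ≥0∞} {c : W → I → ℝ} {t : W → I → W}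

open Classical in
theorem tsum_mul (h : IsFiniteMixture P c t) (w₀ w : W) (g : W → ℝ≥0∞) :
    ∑' w' : {w' : W // w' ≠ w₀}, P w w' * g w' =
      ∑ i with t w i ≠ w₀, ENNReal.ofReal (c w i) * g (t w i) := by
  have h1 : ∑' w' : {w' : W // w' ≠ w₀}, P w w' * g w' =
      ∑' w', ∑ i, if t w i = w' ∧ t w i ≠ w₀ then ENNReal.ofReal (c w i) * g (t w i) else 0 := by
    refine (tsum_subtype {w' | w' ≠ w₀} (fun w' => P w w' * g w')).trans ?_
    refine tsum_congr fun w' => ?_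
    rw [Set.indicator_apply]
    by_cases hw : w' = w₀
    · subst hw
      rw [if_neg (by simp)]
      symm
      refine Finset.sum_eq_zero fun i _ => if_neg ?_
      tauto
    · rw [if_pos (show w' ∈ {w' | w' ≠ w₀} from hw), h.eq_sum, Finset.sum_mul, Finset.sum_filter]
      refine Finset.sum_congr rfl fun i _ => ?_
      by_cases hi : t w i = w'
      · subst hi
        simp [hw]
      · simp [hi]
  rw [h1, Summable.tsum_finsetSum (fun _ _ => ENNReal.summable), Finset.sum_filter]
  refine Finset.sum_congr rfl fun i _ => ?_
  rw [tsum_eq_single (t w i)]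
  · simp
  · intro w' hw'
    rw [if_neg]
    exact fun hh => hw' hh.1.symm

open Classical in
/-- The probability of avoiding `w₀` for `n` steps, as a real number. -/
noncomputable def avoid (c : W → I → ℝ) (t : W → I → W) (w₀ : W) : ℕ → W → ℝ
  | 0, _ => 1
  | n + 1, w => ∑ i with t w i ≠ w₀, c w i * avoid c t w₀ n (t w i)

theorem avoid_nonneg (h : IsFiniteMixture P c t) (w₀ : W) (n : ℕ) (w : W) :
    0 ≤ avoid c t w₀ n w := by
  induction n generalizing w with
  | zero => exact zero_le_one
  | succ n ih => exact Finset.sum_nonneg fun i _ => mul_nonneg (h.nonneg w i) (ih _)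

theorem avoidProb_eq (h : IsFiniteMixture P c t) (w₀ : W) (n : ℕ) (w : W) :
    avoidProb P w₀ n w = ENNReal.ofReal (avoid c t w₀ n w) := by
  induction n generalizing w with
  | zero => simp [avoidProb, avoid]
  | succ n ih =>
    rw [avoidProb, h.tsum_mul, avoid, ENNReal.ofReal_sum_of_nonneg
      fun i _ => mul_nonneg (h.nonneg w i) (h.avoid_nonneg _ _ _)]
    refine Finset.sum_congr rfl fun i _ => ?_
    rw [ih, ENNReal.ofReal_mul (h.nonneg w i)]

open Classical in
theorem sum_avoid_succ (w₀ : W) (n : ℕ) (w : W) :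
    ∑ j ∈ Finset.range (n + 1), avoid c t w₀ j w =
      1 + ∑ i with t w i ≠ w₀, c w i * ∑ j ∈ Finset.range n, avoid c t w₀ j (t w i) := by
  rw [Finset.sum_range_succ', add_comm]
  simp only [avoid, Finset.mul_sum]
  rw [Finset.sum_comm]

open Classical in
-- Optional stopping at `min T n`, where `T` is the hitting time of `w₀`. The left side is the
-- initial value plus the drift accumulated before that time. On the right, the stopped value is `L
-- w₀` if `T ≤ n` and at most `L w + B * n` otherwise.
theorem add_mul_sum_avoid_le (h : IsFiniteMixture P c t) (w₀ : W) (L : W → ℝ) {B δ : ℝ}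
    (hL : ∀ w i, L (t w i) ≤ L w + B) (hdrift : ∀ w, L w + δ ≤ ∑ i, c w i * L (t w i)) (n : ℕ) :
    ∀ w, L w + δ * ∑ j ∈ Finset.range n, avoid c t w₀ j w ≤
      L w₀ * (1 - avoid c t w₀ n w) + (L w + B * n) * avoid c t w₀ n w := by
  set f := avoid c t w₀ with hf
  induction n with
  | zero => intro w; simp [hf, avoid]
  | succ n ih =>
    intro w
    have hsplit : ∀ g : I → ℝ, ∑ i, g i =
        ∑ i with t w i ≠ w₀, g i + ∑ i with ¬ (t w i ≠ w₀), g i := fun g =>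
      (Finset.sum_filter_add_sum_filter_not _ _ _).symm
    have h1 := hdrift w
    rw [hsplit] at h1
    have h2 : ∑ i with ¬ (t w i ≠ w₀), c w i * L (t w i) =
        L w₀ * ∑ i with ¬ (t w i ≠ w₀), c w i := by
      rw [Finset.mul_sum]
      refine Finset.sum_congr rfl fun i hi => ?_
      have : t w i = w₀ := by simpa using hi
      rw [this, mul_comm]
    have h3 := h.sum_eq_one w
    rw [hsplit] at h3
    have h4 : ∑ i with t w i ≠ w₀, c w i * (L (t w i) +
          δ * ∑ j ∈ Finset.range n, f j (t w i)) ≤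
        ∑ i with t w i ≠ w₀, (L w₀ * c w i +
          (L w + B * (n + 1) - L w₀) * (c w i * f n (t w i))) := by
      refine Finset.sum_le_sum fun i _ => ?_
      have h5 := mul_le_mul_of_nonneg_left (ih (t w i)) (h.nonneg w i)
      have h6 := mul_le_mul_of_nonneg_left (hL w i)
        (mul_nonneg (h.nonneg w i) (h.avoid_nonneg w₀ n (t w i)))
      rw [← hf] at h6
      linarith
    simp only [mul_add, Finset.sum_add_distrib, ← Finset.mul_sum] at h4
    have h7 : ∑ i with t w i ≠ w₀, c w i * (δ * ∑ j ∈ Finset.range n, f j (t w i)) =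
        δ * ∑ i with t w i ≠ w₀, c w i * ∑ j ∈ Finset.range n, f j (t w i) := by
      rw [Finset.mul_sum]
      exact Finset.sum_congr rfl fun i _ => by ring
    rw [h7] at h4
    rw [hf, sum_avoid_succ, ← hf]
    have h8 : f (n + 1) w = ∑ i with t w i ≠ w₀, c w i * f n (t w i) := rfl
    rw [← h8] at h4
    push_cast
    rw [h2] at h1
    have h9 : L w₀ * ∑ i with t w i ≠ w₀, c w i + L w₀ * ∑ i with ¬ (t w i ≠ w₀), c w i = L w₀ := by
      rw [← mul_add, h3, mul_one]
    linarith

/-- A chain for which some function has increments bounded above and uniformly positive drift has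
no state with finite mean return time. -/
theorem not_isPositiveRecurrent (h : IsFiniteMixture P c t) (L : W → ℝ) {B δ : ℝ} (hB : 0 < B)
    (hδ : 0 < δ) (hL : ∀ w i, L (t w i) ≤ L w + B)
    (hdrift : ∀ w, L w + δ ≤ ∑ i, c w i * L (t w i)) : ¬ IsPositiveRecurrent P := by
  rintro ⟨w₀, hw₀⟩
  have key := h.add_mul_sum_avoid_le w₀ L hL hdrift
  generalize hf : avoid c t w₀ = f at key
  have hf0 : ∀ n w, 0 ≤ f n w := fun n w => hf ▸ h.avoid_nonneg w₀ n w
  -- Started from `w₀`, the terms in `L w₀` cancel and leave `δ ≤ B * n * P(T > n)` for `n ≥ 1`. The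
  -- mean return time then dominates a harmonic series.
  have hpos : ∀ n : ℕ, δ / B * (1 / ((n + 1 : ℕ) : ℝ)) ≤ f (n + 1) w₀ := by
    intro n
    have h1 := key (n + 1) w₀
    have h2 : 1 ≤ ∑ j ∈ Finset.range (n + 1), f j w₀ := by
      rw [Finset.sum_range_succ']
      have : 0 ≤ ∑ k ∈ Finset.range n, f (k + 1) w₀ :=
        Finset.sum_nonneg fun _ _ => hf0 _ _
      have h0 : f 0 w₀ = 1 := by rw [← hf, avoid]
      linarith
    have h3 : δ ≤ B * ((n + 1 : ℕ) : ℝ) * f (n + 1) w₀ := by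
      have h4 := mul_le_mul_of_nonneg_left h2 hδ.le
      linarith
    rw [div_mul_div_comm, mul_one, div_le_iff₀ (by positivity)]
    linarith
  have hsum : Summable fun n => f n w₀ := by
    have h1 := ENNReal.summable_toReal (hw₀ w₀).ne
    refine h1.congr fun n => ?_
    rw [h.avoidProb_eq, hf, ENNReal.toReal_ofReal (hf0 _ _)]
  have h1 : Summable fun n : ℕ => δ / B * (1 / ((n + 1 : ℕ) : ℝ)) :=
    Summable.of_nonneg_of_le (fun n => by positivity) hpos
      ((summable_nat_add_iff 1).2 hsum)
  rw [summable_mul_left_iff (by positivity)] at h1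
  exact Real.not_summable_one_div_natCast ((summable_nat_add_iff 1).1 h1)

open Classical in
-- The mean hitting time is the least nonnegative solution of the one-step equation, so any
-- supersolution `H` bounds its partial sums by induction.
theorem meanHittingTime_lt_top (h : IsFiniteMixture P c t) (w₀ : W) (H : W → ℝ)
    (hH₀ : ∀ w, 0 ≤ H w)
    (hH : ∀ w, 1 + ∑ i with t w i ≠ w₀, c w i * H (t w i) ≤ H w) (w : W) :
    meanHittingTime P w₀ w < ∞ := by
  have key : ∀ n w, ∑ j ∈ Finset.range n, avoid c t w₀ j w ≤ H w := by
    intro n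
    induction n with
    | zero => simpa using hH₀
    | succ n ih =>
      intro w
      rw [sum_avoid_succ]
      refine le_trans ?_ (hH w)
      gcongr with i
      · exact h.nonneg w i
      · exact ih _
  refine lt_of_le_of_lt ?_ (ENNReal.ofReal_lt_top (r := H w))
  refine ENNReal.tsum_le_of_sum_range_le fun n => ?_
  simp only [h.avoidProb_eq]
  rw [← ENNReal.ofReal_sum_of_nonneg fun _ _ => h.avoid_nonneg _ _ _]
  exact ENNReal.ofReal_le_ofReal (key n w)

/-- A Foster–Lyapunov criterion: `V` has drift at most `b - θ s`, and from every state the chain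
either reaches `w₀` or decreases `s` in one step with probability at least `p`. -/
theorem isPositiveRecurrent (h : IsFiniteMixture P c t) (w₀ : W) (V : W → ℝ) (s : W → ℕ)
    {b θ p : ℝ} (hb : 0 ≤ b) (hθ : 0 < θ) (hp : 0 < p) (hV : ∀ w, 0 ≤ V w)
    (hdrift : ∀ w, ∑ i, c w i * V (t w i) ≤ V w + b - θ * s w)
    (hstep : ∀ w, ∃ i, p ≤ c w i ∧ (t w i = w₀ ∨ s (t w i) < s w)) :
    IsPositiveRecurrent P := by
  classical
  refine ⟨w₀, ?_⟩
  have hp1 : p ≤ 1 := by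
    obtain ⟨i, hi, -⟩ := hstep w₀
    exact hi.trans ((Finset.single_le_sum (fun j _ => h.nonneg w₀ j) (Finset.mem_univ i)).trans
      (h.sum_eq_one w₀).le)
  obtain ⟨n, hn⟩ := exists_nat_gt ((b + 1) / θ)
  rw [div_lt_iff₀ hθ] at hn
  set η := p / 2 with hη
  have hη0 : 0 < η := by positivity
  have hη1 : η ≤ 1 := by linarith
  -- Adding the bounded function `M * (1 - η ^ (s + 1))` to `V` handles the states with `s ≤ n`. The
  -- favourable move lowers its mean by at least `2 * η * M * η ^ s`, while all other moves together
  -- raise it by at most `η * M * η ^ s`. The net gain is at least `b + 1` by the choice of `M`.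
  -- Above level `n` the drift of `V` suffices.
  set M := (b + 1) / (η ^ n * η) with hM
  have hM0 : 0 ≤ M := by positivity
  have hM1 : M * (η ^ n * η) = b + 1 := div_mul_cancel₀ _ (by positivity)
  refine h.meanHittingTime_lt_top w₀ (fun w => V w + M * (1 - η ^ (s w + 1))) ?_ ?_
  · intro w
    exact add_nonneg (hV w) (mul_nonneg hM0 (sub_nonneg.2 (pow_le_one₀ hη0.le hη1)))
  · intro w
    obtain ⟨i₀, hi₀, hi₁⟩ := hstep w
    simp only [mul_add, Finset.sum_add_distrib]
    have h1 : ∑ i with t w i ≠ w₀, c w i * V (t w i) ≤ ∑ i, c w i * V (t w i) :=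
      Finset.sum_le_sum_of_subset_of_nonneg (Finset.filter_subset _ _)
        fun i _ _ => mul_nonneg (h.nonneg w i) (hV _)
    have h2 : ∑ i with t w i ≠ w₀, c w i * (M * (1 - η ^ (s (t w i) + 1))) ≤
        ∑ i, (c w i * M - if i = i₀ then c w i * (M * η ^ s w) else 0) := by
      rw [Finset.sum_filter]
      refine Finset.sum_le_sum fun i _ => ?_
      have hc := h.nonneg w i
      have hle : (1 - η ^ s w) ≥ 0 := sub_nonneg.2 (pow_le_one₀ hη0.le hη1)
      have hpow : 0 ≤ η ^ (s (t w i) + 1) := by positivity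
      split_ifs with ha hb hb
      · subst hb
        have hlt := hi₁.resolve_left ha
        have : η ^ s w ≤ η ^ (s (t w i) + 1) := pow_le_pow_of_le_one hη0.le hη1 hlt
        nlinarith [mul_nonneg hc hM0]
      · nlinarith [mul_nonneg (mul_nonneg hc hM0) hpow]
      · nlinarith [mul_nonneg (mul_nonneg hc hM0) hle]
      · simpa using mul_nonneg hc hM0
    rw [Finset.sum_sub_distrib, ← Finset.sum_mul, h.sum_eq_one, one_mul,
      Finset.sum_ite_eq' Finset.univ i₀, if_pos (Finset.mem_univ _)] at h2
    have h3 : p * (M * η ^ s w) ≤ c w i₀ * (M * η ^ s w) :=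
      mul_le_mul_of_nonneg_right hi₀ (by positivity)
    have h4 : b + 1 - θ * s w ≤ η * (M * η ^ s w) := by
      by_cases hs : s w ≤ n
      · have : η ^ n ≤ η ^ s w := pow_le_pow_of_le_one hη0.le hη1 hs
        have h5 : M * (η ^ n * η) ≤ M * (η ^ s w * η) := by gcongr
        have : 0 ≤ θ * s w := by positivity
        nlinarith
      · have : (n : ℝ) ≤ s w := by exact_mod_cast (not_le.1 hs).le
        have h5 : (n : ℝ) * θ ≤ s w * θ := by gcongr
        have : 0 ≤ η * (M * η ^ s w) := by positivity
        linarith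
    have h5 := hdrift w
    have h6 : p = 2 * η := by rw [hη]; ring
    rw [h6] at h3
    have h7 : M * (1 - η ^ (s w + 1)) = M - η * (M * η ^ s w) := by ring
    simp only [mul_sub, mul_one, pow_succ] at h2 ⊢
    nlinarith

end IsFiniteMixture

/-- A chain on a larger state space whose moves ignore the extra coordinate and land on a section
of the projection is positive recurrent if the projected chain is. -/
theorem IsPositiveRecurrent.lift {W W' : Type} {P : W → W → ℝ≥0∞} {P' : W' → W' → ℝ≥0∞}
    (hP : IsPositiveRecurrent P) (π : W' → W) (σ : W → W') (hπσ : ∀ w, π (σ w) = w)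
    (hσ : ∀ w' v, P' w' (σ v) = P (π w') v)
    (h0 : ∀ w' v', σ (π v') ≠ v' → P' w' v' = 0) : IsPositiveRecurrent P' := by
  classical
  obtain ⟨w₀, hw₀⟩ := hP
  have hinj : Function.Injective σ := Function.LeftInverse.injective hπσ
  have key : ∀ n w', avoidProb P' (σ w₀) n w' = avoidProb P w₀ n (π w') := by
    intro n
    induction n with
    | zero => intro w'; rfl
    | succ n ih =>
      intro w'
      refine (tsum_subtype {v' | v' ≠ σ w₀} (fun v' => P' w' v' * avoidProb P' (σ w₀) n v')).trans
        (Eq.trans ?_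
          (tsum_subtype {v | v ≠ w₀} (fun v => P (π w') v * avoidProb P w₀ n v)).symm)
      -- Only states in the image of `σ` can be entered, so the sum is carried by that image.
      rw [← hinj.tsum_eq]
      · refine tsum_congr fun v => ?_
        simp only [Set.indicator_apply, Set.mem_ofPred_eq, hσ, ih, hπσ, ne_eq, hinj.eq_iff]
      · intro v' hv'
        by_contra hcon
        refine hv' ?_
        have : P' w' v' = 0 := h0 w' v' fun hh => hcon ⟨_, hh⟩
        simp [Set.indicator_apply, this]
  refine ⟨σ w₀, fun w' => ?_⟩
  have := hw₀ (π w')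
  simpa only [meanHittingTime, key] using this

/-! ### The one-step law for a memoryless receiver -/

section

variable {N : ℕ} {S : Finset (Fin N → ℕ)} {X Y : Type} {k : ℕ}

/-- The law of the encoder's output. -/
noncomputable def EncodingPolicy.prob {v : ℕ} (φ : EncodingPolicy N X k v) (w : State N X Y k v)
    (p : X × Memory k) : ℝ :=
  volume.real {u | φ.toFun w.queue w.arrival w.encMem w.recMem u = p}

theorem EncodingPolicy.prob_nonneg {v : ℕ} (φ : EncodingPolicy N X k v) (w : State N X Y k v)
    (p : X × Memory k) : 0 ≤ φ.prob w p := measureReal_nonneg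

theorem EncodingPolicy.sum_prob [Fintype X] {v : ℕ} (φ : EncodingPolicy N X k v)
    (w : State N X Y k v) : ∑ p, φ.prob w p = 1 := by
  have h := sum_measureReal_preimage_singleton (μ := (volume : Measure unitInterval))
    (Finset.univ : Finset (X × Memory k))
    (f := φ.toFun w.queue w.arrival w.encMem w.recMem) fun p _ => φ.measurable _ _ _ _ p
  rw [Finset.coe_univ, Set.preimage_univ, probReal_univ] at h
  exact h

/-- The law of the schedule allocated by a memoryless receiver. -/
noncomputable def AllocationPolicy.prob (ψ : AllocationPolicy S Y 0) (y : Y) (d : Fin N → ℕ) : ℝ :=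
  volume.real {u | ψ.allocate y default u = d}

theorem AllocationPolicy.prob_nonneg (ψ : AllocationPolicy S Y 0) (y : Y) (d : Fin N → ℕ) :
    0 ≤ ψ.prob y d := measureReal_nonneg

theorem AllocationPolicy.sum_prob (ψ : AllocationPolicy S Y 0) (y : Y) :
    ∑ d : S, ψ.prob y d = 1 := by
  have h := sum_measureReal_preimage_singleton (μ := (volume : Measure unitInterval)) S
    (f := ψ.allocate y default) fun d _ => ψ.measurable_allocate _ _ d
  have h2 : ψ.allocate y default ⁻¹' (S : Set (Fin N → ℕ)) = Set.univ :=
    Set.eq_univ_of_forall fun u => ψ.allocate_mem _ _ _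
  rw [h2, probReal_univ, ← Finset.sum_coe_sort] at h
  exact h

/-- The law of the arrivals. -/
noncomputable def arrivalWeight (lam : Fin N → ℝ) (a : Fin N → Bool) : ℝ :=
  ∏ i, if a i then lam i else 1 - lam i

section arrivalWeight

variable {lam : Fin N → ℝ}

theorem arrivalWeight_nonneg (hlam : ∀ i, 0 ≤ lam i ∧ lam i ≤ 1) (a : Fin N → Bool) :
    0 ≤ arrivalWeight lam a := by
  refine Finset.prod_nonneg fun i _ => ?_
  have := hlam i
  split_ifs <;> linarith

theorem arrivalProb_eq (hlam : ∀ i, 0 ≤ lam i ∧ lam i ≤ 1) (a : Fin N → Bool) :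
    arrivalProb lam a = ENNReal.ofReal (arrivalWeight lam a) := by
  rw [arrivalProb, arrivalWeight, ENNReal.ofReal_prod_of_nonneg]
  · refine Finset.prod_congr rfl fun i _ => ?_
    split_ifs <;> rfl
  · intro i _
    have := hlam i
    split_ifs <;> linarith

theorem sum_arrivalWeight : ∑ a, arrivalWeight lam a = 1 := by
  have h := Finset.prod_univ_sum (fun _ : Fin N => (Finset.univ : Finset Bool))
    fun i b => if b then lam i else 1 - lam i
  simp only [Fintype.piFinset_univ] at h
  unfold arrivalWeight
  rw [← h]
  simp

theorem sum_arrivalWeight_mul (i : Fin N) :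
    ∑ a, arrivalWeight lam a * ((a i).toNat : ℝ) = lam i := by
  have h := Finset.prod_univ_sum (fun _ : Fin N => (Finset.univ : Finset Bool))
    fun j b => (if b then lam j else 1 - lam j) * (if j = i then (b.toNat : ℝ) else 1)
  simp only [Fintype.piFinset_univ, Finset.prod_mul_distrib, Finset.prod_ite_eq', Finset.mem_univ,
    if_true] at h
  unfold arrivalWeight
  rw [← h, Finset.prod_eq_single i]
  · simp
  · intro j _ hj
    simp [hj]
  · simp

theorem sum_arrivalWeight_linear (α : ℝ) (β : Fin N → ℝ) :
    ∑ a, arrivalWeight lam a * (α + ∑ i, β i * ((a i).toNat : ℝ)) = α + ∑ i, β i * lam i := by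
  simp only [mul_add, Finset.sum_add_distrib, ← Finset.sum_mul, sum_arrivalWeight, one_mul,
    Finset.mul_sum]
  rw [Finset.sum_comm]
  congr 1
  refine Finset.sum_congr rfl fun i _ => ?_
  rw [← sum_arrivalWeight_mul (lam := lam) i, Finset.mul_sum]
  exact Finset.sum_congr rfl fun a _ => by ring

end arrivalWeight

variable [Fintype Y]

/-- The probability of a combination of random choices made in one step. -/
noncomputable def moveProb (C : Channel X Y) (φ : EncodingPolicy N X k 0)
    (ψ : AllocationPolicy S Y 0) (lam : Fin N → ℝ) (w : State N X Y k 0)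
    (j : (X × Memory k) × Y × (Fin N → Bool) × S) : ℝ :=
  φ.prob w j.1 * (C.matrix j.1.1 j.2.1 * (arrivalWeight lam j.2.2.1 * ψ.prob j.2.1 j.2.2.2))

/-- The state reached after a combination of random choices. -/
def moveTarget (w : State N X Y k 0) (j : (X × Memory k) × Y × (Fin N → Bool) × S) :
    State N X Y k 0 where
  queue i := w.queue i - j.2.2.2.1 i + (j.2.2.1 i).toNat
  arrival := j.2.2.1
  encMem := j.1.2
  signal := j.1.1
  message := j.2.1
  recMem := default

/-- Both Lyapunov functions, linear and quadratic, have increments bounded by expressions affine in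
the arrivals and the schedule. Their drift thus depends only on the rates and the mean service. -/
theorem sum_moveProb_mul [Fintype X] (C : Channel X Y) (φ : EncodingPolicy N X k 0)
    (ψ : AllocationPolicy S Y 0) (lam : Fin N → ℝ) (w : State N X Y k 0)
    (α : ℝ) (β γ : Fin N → ℝ) :
    ∑ j : (X × Memory k) × Y × (Fin N → Bool) × S, moveProb C φ ψ lam w j *
      (α + ∑ i, β i * ((j.2.2.1 i).toNat : ℝ) - ∑ i, γ i * (j.2.2.2.1 i : ℝ)) =
    α + ∑ i, β i * lam i - ∑ p, φ.prob w p * ∑ y, C.matrix p.1 y *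
      ∑ d : S, ψ.prob y d * ∑ i, γ i * (d.1 i : ℝ) := by
  have h1 : ∀ y : Y, ∑ a, ∑ d : S, arrivalWeight lam a * ψ.prob y d *
      (α + ∑ i, β i * ((a i).toNat : ℝ) - ∑ i, γ i * (d.1 i : ℝ)) =
      (α + ∑ i, β i * lam i) - ∑ d : S, ψ.prob y d * ∑ i, γ i * (d.1 i : ℝ) := by
    intro y
    have h2 : ∀ a, ∑ d : S, arrivalWeight lam a * ψ.prob y d *
        (α + ∑ i, β i * ((a i).toNat : ℝ) - ∑ i, γ i * (d.1 i : ℝ)) =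
        arrivalWeight lam a * (α + ∑ i, β i * ((a i).toNat : ℝ)) -
        arrivalWeight lam a * ∑ d : S, ψ.prob y d * ∑ i, γ i * (d.1 i : ℝ) := by
      intro a
      simp only [mul_sub, Finset.sum_sub_distrib, ← Finset.sum_mul, ← Finset.mul_sum, mul_assoc]
      rw [ψ.sum_prob, one_mul]
    simp only [h2]
    simp only [Finset.sum_sub_distrib, sum_arrivalWeight_linear, ← Finset.sum_mul,
      sum_arrivalWeight, one_mul]
  simp only [Fintype.sum_prod_type (α₁ := X × Memory k), Fintype.sum_prod_type (α₁ := Y),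
    Fintype.sum_prod_type (α₁ := Fin N → Bool), moveProb, mul_assoc, ← Finset.mul_sum]
  simp only [mul_assoc, ← Finset.mul_sum] at h1
  simp only [h1]
  simp only [mul_sub, Finset.sum_sub_distrib, ← Finset.sum_mul, C.row_sum, one_mul,
    φ.sum_prob]

theorem isFiniteMixture_transition [Fintype X] (C : Channel X Y) (φ : EncodingPolicy N X k 0)
    (ψ : AllocationPolicy S Y 0) {lam : Fin N → ℝ} (hlam : ∀ i, 0 ≤ lam i ∧ lam i ≤ 1) :
    IsFiniteMixture (transition C φ ψ lam) (moveProb C φ ψ lam) moveTarget where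
  nonneg w j := mul_nonneg (φ.prob_nonneg _ _) (mul_nonneg (C.nonneg _ _)
    (mul_nonneg (arrivalWeight_nonneg hlam _) (ψ.prob_nonneg _ _)))
  sum_eq_one w := by
    simpa using sum_moveProb_mul C φ ψ lam w 1 0 0
  eq_sum w w' := by
    classical
    let F : (Fin N → ℕ) → Prop := fun d => ∀ i, w'.queue i = w.queue i - d i + (w'.arrival i).toNat
    have hr : w.recMem = default := Subsingleton.elim _ _
    have h1 : volume {u : unitInterval | (∀ i, w'.queue i =
          (w.queue i - ψ.allocate w'.message w.recMem u i) + (w'.arrival i).toNat) ∧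
          w'.recMem = ψ.update w.message w.recMem u} =
        ∑ d ∈ Finset.univ.filter (fun d : S => F d), ENNReal.ofReal (ψ.prob w'.message d) := by
      have h2 := sum_measure_preimage_singleton (μ := (volume : Measure unitInterval))
        (S.filter F) (f := ψ.allocate w'.message default) fun d _ => ψ.measurable_allocate _ _ d
      have h3 : {u : unitInterval | (∀ i, w'.queue i =
          (w.queue i - ψ.allocate w'.message w.recMem u i) + (w'.arrival i).toNat) ∧
          w'.recMem = ψ.update w.message w.recMem u} =
          ψ.allocate w'.message default ⁻¹' (S.filter F : Finset (Fin N → ℕ)) := by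
        ext u
        have hu : w'.recMem = ψ.update w.message w.recMem u := Subsingleton.elim _ _
        rw [← hr, Set.mem_preimage, Finset.mem_coe, Finset.mem_filter]
        exact ⟨fun hh => ⟨ψ.allocate_mem _ _ _, hh.1⟩, fun hh => ⟨hh.2, hu⟩⟩
      rw [h3, ← h2, Finset.sum_filter, Finset.sum_filter, ← Finset.sum_coe_sort]
      refine Finset.sum_congr rfl fun d _ => ?_
      split_ifs
      · rw [AllocationPolicy.prob, ofReal_measureReal]
        rfl
      · rfl
    have h4 : volume {u : unitInterval |
        φ.toFun w.queue w.arrival w.encMem w.recMem u = (w'.signal, w'.encMem)} =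
        ENNReal.ofReal (φ.prob w (w'.signal, w'.encMem)) := by
      rw [EncodingPolicy.prob, ofReal_measureReal]
    rw [transition, h1, h4, arrivalProb_eq hlam, Finset.mul_sum]
    -- The target state determines every choice except the schedule: truncation at zero lets several
    -- schedules produce the same queues.
    refine Finset.sum_nbij' (fun d => ((w'.signal, w'.encMem), w'.message, w'.arrival, d))
      (fun j => j.2.2.2) ?_ ?_ ?_ ?_ ?_
    · intro d hd
      simp only [Finset.mem_filter_univ] at hd ⊢
      obtain ⟨q', a', m', x', y', r'⟩ := w'
      simp only [moveTarget, State.mk.injEq, Subsingleton.elim r' default, and_true]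
      exact (funext hd).symm
    · rintro ⟨⟨x, m⟩, y, a, d⟩ hj
      simp only [Finset.mem_filter_univ] at hj ⊢
      subst hj
      exact fun i => rfl
    · intro d _
      rfl
    · rintro ⟨⟨x, m⟩, y, a, d⟩ hj
      simp only [Finset.mem_filter_univ] at hj
      subst hj
      rfl
    · intro d _
      rw [moveProb, ENNReal.ofReal_mul (φ.prob_nonneg _ _), ENNReal.ofReal_mul (C.nonneg _ _),
        ENNReal.ofReal_mul (arrivalWeight_nonneg hlam _)]
      ring

end

/-! ### Geometry of the schedule hull and the optimal fraction -/

section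

variable {N : ℕ} {S : Finset (Fin N → ℕ)}

theorem IsScheduleSet.nonempty (hS : IsScheduleSet S) : S.Nonempty := by
  obtain ⟨d, -, -, hd, -⟩ := hS.two_maximal
  exact ⟨d, hd.prop⟩

/-- The support function of the schedule set. -/
noncomputable def maxWeight (hS : IsScheduleSet S) (w : Fin N → ℝ) : ℝ :=
  S.sup' hS.nonempty fun d => ∑ i, w i * (d i : ℝ)

theorem le_maxWeight (hS : IsScheduleSet S) (w : Fin N → ℝ) {d : Fin N → ℕ} (hd : d ∈ S) :
    ∑ i, w i * (d i : ℝ) ≤ maxWeight hS w :=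
  Finset.le_sup' (fun d : Fin N → ℕ => ∑ i, w i * (d i : ℝ)) hd

theorem exists_eq_maxWeight (hS : IsScheduleSet S) (w : Fin N → ℝ) :
    ∃ d ∈ S, ∑ i, w i * (d i : ℝ) = maxWeight hS w := by
  obtain ⟨d, hd, h⟩ := Finset.exists_mem_eq_sup' hS.nonempty
    fun d : Fin N → ℕ => ∑ i, w i * (d i : ℝ)
  exact ⟨d, hd, h.symm⟩

theorem mem_scheduleHull {d : Fin N → ℕ} (hd : d ∈ S) :
    (fun i => (d i : ℝ)) ∈ scheduleHull S :=
  subset_convexHull ℝ _ ⟨d, hd, rfl⟩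

theorem sum_mul_le_maxWeight (hS : IsScheduleSet S) (w : Fin N → ℝ) {z : Fin N → ℝ}
    (hz : z ∈ scheduleHull S) : ∑ i, w i * z i ≤ maxWeight hS w := by
  have hlin : IsLinearMap ℝ fun z : Fin N → ℝ => ∑ i, w i * z i :=
    ⟨fun x y => by simp [mul_add, Finset.sum_add_distrib],
      fun a x => by simp [Finset.mul_sum, mul_left_comm]⟩
  refine convexHull_min (t := {z | ∑ i, w i * z i ≤ maxWeight hS w}) ?_
    (convex_halfSpace_le hlin _) hz
  rintro _ ⟨d, hd, rfl⟩
  exact le_maxWeight hS w hd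

theorem exists_le_of_mem_scheduleHull (hS : IsScheduleSet S) {z : Fin N → ℝ}
    (hz : z ∈ scheduleHull S) (i : Fin N) : ∃ d ∈ S, z i ≤ d i := by
  obtain ⟨d, hd, h⟩ := exists_eq_maxWeight hS (Pi.single i 1)
  have h1 := sum_mul_le_maxWeight hS (Pi.single i 1) hz
  rw [← h] at h1
  refine ⟨d, hd, ?_⟩
  simpa [Pi.single_apply] using h1

theorem isCompact_scheduleHull : IsCompact (scheduleHull S) :=
  (S.finite_toSet.image _).isCompact_convexHull ℝ

/-- A point of the hull with all coordinates positive. -/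
theorem exists_pos_mem_scheduleHull (hS : IsScheduleSet S) :
    ∃ z ∈ scheduleHull S, ∀ i, 0 < z i := by
  obtain ⟨c, hc, hcS⟩ := hS.serves_each
  rcases isEmpty_or_nonempty (Fin N) with hN | hN
  · obtain ⟨d, hd⟩ := hS.nonempty
    exact ⟨_, mem_scheduleHull hd, fun i => hN.elim i⟩
  · have hcard : (0 : ℝ) < Fintype.card (Fin N) := by exact_mod_cast Fintype.card_pos
    refine ⟨∑ j : Fin N, (1 / (Fintype.card (Fin N) : ℝ)) •
      fun i => ((Pi.single j c : Fin N → ℕ) i : ℝ), ?_, fun i => ?_⟩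
    · refine (convex_convexHull ℝ _).sum_mem (fun _ _ => by positivity) ?_
        fun j _ => mem_scheduleHull (hcS j)
      rw [Finset.sum_const, nsmul_eq_mul, Finset.card_univ]
      field_simp
    · rw [Finset.sum_apply]
      refine Finset.sum_pos' (fun j _ => by simp only [Pi.smul_apply, smul_eq_mul]; positivity)
        ⟨i, Finset.mem_univ _, ?_⟩
      simp only [Pi.smul_apply, smul_eq_mul, Pi.single_eq_same]
      positivity

/-- One factor `1 - τ` pays for mixing `d` with a strictly positive point of the hull, the other for
strict domination in every coordinate. -/
theorem exists_mem_maxCapacityRegion (hS : IsScheduleSet S) {d : Fin N → ℕ} (hd : d ∈ S) {τ : ℝ}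
    (h0 : 0 < τ) (h1 : τ < 1) :
    ∃ lam ∈ maxCapacityRegion S, ∀ i, (1 - τ) ^ 2 * d i ≤ lam i := by
  obtain ⟨z, hz, hzpos⟩ := exists_pos_mem_scheduleHull hS
  have hmem : (1 - τ) • (fun i => (d i : ℝ)) + τ • z ∈ scheduleHull S :=
    convex_convexHull ℝ _ (mem_scheduleHull hd) hz (by linarith) h0.le (by ring)
  have hpos : ∀ i, 0 < ((1 - τ) • (fun i => (d i : ℝ)) + τ • z) i := fun i => by
    simp only [Pi.add_apply, Pi.smul_apply, smul_eq_mul]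
    have := mul_pos h0 (hzpos i)
    have : 0 ≤ (1 - τ) * (d i : ℝ) := mul_nonneg (by linarith) (Nat.cast_nonneg _)
    linarith
  refine ⟨(1 - τ) • ((1 - τ) • (fun i => (d i : ℝ)) + τ • z),
    ⟨fun i => mul_nonneg (by linarith) (hpos i).le, _, hmem, fun i => ?_⟩, fun i => ?_⟩
  · rw [Pi.smul_apply, smul_eq_mul]
    nlinarith [mul_pos h0 (hpos i)]
  · simp only [Pi.add_apply, Pi.smul_apply, smul_eq_mul]
    have : 0 ≤ (1 - τ) * (τ * z i) := mul_nonneg (by linarith) (mul_nonneg h0.le (hzpos i).le)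
    linarith

/-- The pairs `(r, m)` such that a memoryless receiver whose schedule, when the message carries no
information, has mean `m` can support the fraction `r` of the maximum capacity region. -/
def feasibleSet (hS : IsScheduleSet S) (ε : ℝ) : Set (ℝ × (Fin N → ℝ)) :=
  {p | 0 ≤ p.1 ∧ (∀ d ∈ S, ∀ i, p.1 * d i ≤ 1) ∧ p.2 ∈ scheduleHull S ∧
    ∀ w : Fin N → ℝ, (∀ i, 0 ≤ w i) →
      p.1 * maxWeight hS w ≤ (1 - ε) * maxWeight hS w + ε * ∑ i, w i * p.2 i}

theorem IsScheduleSet.exists_index (hS : IsScheduleSet S) : Nonempty (Fin N) := by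
  obtain ⟨d₁, d₂, hne, -⟩ := hS.two_maximal
  obtain ⟨i, -⟩ := Function.ne_iff.1 hne
  exact ⟨i⟩

theorem isCompact_feasibleSet (hS : IsScheduleSet S) (ε : ℝ) : IsCompact (feasibleSet hS ε) := by
  refine ((isCompact_Icc (a := 0) (b := 1)).prod
    (isCompact_scheduleHull (S := S))).of_isClosed_subset ?_ ?_
  · have hset : feasibleSet hS ε = {p : ℝ × (Fin N → ℝ) | 0 ≤ p.1} ∩
        ((⋂ d ∈ S, ⋂ i, {p : ℝ × (Fin N → ℝ) | p.1 * (d i : ℝ) ≤ 1}) ∩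
        ((Prod.snd ⁻¹' scheduleHull S) ∩ ⋂ (w : Fin N → ℝ) (_ : ∀ i, 0 ≤ w i),
          {p : ℝ × (Fin N → ℝ) | p.1 * maxWeight hS w ≤
            (1 - ε) * maxWeight hS w + ε * ∑ i, w i * p.2 i})) := by
      ext p
      simp [feasibleSet]
    rw [hset]
    refine (isClosed_le continuous_const continuous_fst).inter (IsClosed.inter ?_
      ((isCompact_scheduleHull.isClosed.preimage continuous_snd).inter ?_))
    · exact isClosed_biInter fun d _ => isClosed_iInter fun i =>
        isClosed_le (by fun_prop) continuous_const
    · exact isClosed_iInter fun w => isClosed_iInter fun _ =>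
        isClosed_le (by fun_prop) (by fun_prop)
  · rintro ⟨r, m⟩ ⟨h0, h1, hm, -⟩
    refine ⟨⟨h0, ?_⟩, hm⟩
    -- The integer `c` is at least one, so the rate constraint for a single-queue schedule already
    -- forces `r ≤ 1`.
    obtain ⟨c, hc, hcS⟩ := hS.serves_each
    obtain ⟨i⟩ := hS.exists_index
    have h2 := h1 _ (hcS i) i
    rw [Pi.single_eq_same] at h2
    have : (1 : ℝ) ≤ c := by exact_mod_cast hc
    simp only at h0 h2 ⊢
    nlinarith

theorem exists_isMaxOn_feasibleSet (hS : IsScheduleSet S) {ε : ℝ} (h0 : 0 < ε) (h1 : ε < 1) :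
    ∃ p ∈ feasibleSet hS ε, ∀ p' ∈ feasibleSet hS ε, p'.1 ≤ p.1 := by
  obtain ⟨d, hd⟩ := hS.nonempty
  refine (isCompact_feasibleSet hS ε).exists_isMaxOn ⟨(0, fun i => (d i : ℝ)), le_rfl, ?_,
    mem_scheduleHull hd, ?_⟩ continuous_fst.continuousOn
  · intro d _ i
    simp
  · intro w hw
    have h2 : 0 ≤ ∑ i, w i * (d i : ℝ) :=
      Finset.sum_nonneg fun i _ => mul_nonneg (hw i) (Nat.cast_nonneg _)
    have h3 := h2.trans (le_maxWeight hS w hd)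
    have h4 := mul_nonneg (sub_nonneg.2 h1.le) h3
    have h5 := mul_nonneg h0.le h2
    simp only [zero_mul]
    linarith

/-- No point of the hull dominates two distinct maximal schedules. -/
theorem exists_lt_of_mem_scheduleHull (hS : IsScheduleSet S) {m : Fin N → ℝ}
    (hm : m ∈ scheduleHull S) : ∃ d ∈ S, ∃ i, m i < d i := by
  by_contra! hcon
  -- A dominating `m` has total at most that of the largest schedule `d`, hence equals `d`. Then `d`
  -- is a greatest element, and both maximal schedules coincide with it.
  obtain ⟨d, hd, h⟩ := exists_eq_maxWeight hS 1
  have h1 := sum_mul_le_maxWeight hS 1 hm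
  rw [← h] at h1
  simp only [Pi.one_apply, one_mul] at h1
  have h2 : ∀ i, (d i : ℝ) = m i := by
    have := (Finset.sum_eq_sum_iff_of_le fun i _ => hcon d hd i).1
      (le_antisymm (Finset.sum_le_sum fun i _ => hcon d hd i) h1)
    exact fun i => this i (Finset.mem_univ _)
  have h3 : ∀ d' ∈ S, d' ≤ d := fun d' hd' i => by
    have := hcon d' hd' i
    rw [← h2 i] at this
    exact_mod_cast this
  obtain ⟨d₁, d₂, hne, hd₁, hd₂⟩ := hS.two_maximal
  exact hne ((hd₁.eq_of_le hd (h3 _ hd₁.prop)).trans (hd₂.eq_of_le hd (h3 _ hd₂.prop)).symm)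

/-- Some coordinate `i` has `m i < d i` for a schedule `d`; the constraint in direction `e_i` is
then strict. -/
theorem lt_one_of_mem_feasibleSet (hS : IsScheduleSet S) {ε : ℝ} (h0 : 0 < ε)
    {p : ℝ × (Fin N → ℝ)} (hp : p ∈ feasibleSet hS ε) : p.1 < 1 := by
  obtain ⟨-, -, hm, hw⟩ := hp
  obtain ⟨d, hd, i, hi⟩ := exists_lt_of_mem_scheduleHull hS hm
  have h1 := hw (Pi.single i 1) fun j => by
    by_cases hj : j = i
    · subst hj; simp
    · simp [hj]
  have h2 := le_maxWeight hS (Pi.single i 1) hd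
  simp only [Pi.single_apply, ite_mul, one_mul, zero_mul, Finset.sum_ite_eq', Finset.mem_univ,
    if_true] at h1 h2
  generalize maxWeight hS (Pi.single i 1) = h at h1 h2
  have h3 : ε * p.2 i < ε * h := mul_lt_mul_of_pos_left (hi.trans_le h2) h0
  have hmi : p.1 * h < 1 * h := by linarith
  by_contra! hcon
  by_cases hh : 0 ≤ h
  · nlinarith
  · have : (0 : ℝ) ≤ d i := Nat.cast_nonneg _
    linarith

/-! ### Upper bound for every majorizing channel -/

section

variable {X Y : Type} {k : ℕ} [Fintype Y]

/-- The mean schedule allocated by a memoryless receiver when the message has law `q`. -/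
noncomputable def AllocationPolicy.meanService (ψ : AllocationPolicy S Y 0) (q : Y → ℝ) :
    Fin N → ℝ :=
  ∑ y, q y • ∑ d : S, ψ.prob y d • fun i => (d.1 i : ℝ)

theorem AllocationPolicy.meanService_mem (ψ : AllocationPolicy S Y 0) {q : Y → ℝ}
    (hq : ∀ y, 0 ≤ q y) (hq1 : ∑ y, q y = 1) : ψ.meanService q ∈ scheduleHull S :=
  (convex_convexHull ℝ _).sum_mem (fun y _ => hq y) hq1 fun y _ =>
    (convex_convexHull ℝ _).sum_mem (fun d _ => ψ.prob_nonneg y d) (ψ.sum_prob y)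
      fun d _ => mem_scheduleHull d.2

theorem AllocationPolicy.sum_mul_meanService (ψ : AllocationPolicy S Y 0) (q : Y → ℝ)
    (w : Fin N → ℝ) : ∑ i, w i * ψ.meanService q i =
      ∑ y, q y * ∑ d : S, ψ.prob y d * ∑ i, w i * (d.1 i : ℝ) := by
  simp only [meanService, Finset.sum_apply, Pi.smul_apply, smul_eq_mul, Finset.mul_sum]
  rw [Finset.sum_comm]
  refine Finset.sum_congr rfl fun y _ => ?_
  rw [Finset.sum_comm]
  exact Finset.sum_congr rfl fun d _ => Finset.sum_congr rfl fun i _ => by ring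

/-- Stabilized arrival rates are bounded by the mean service that is available. -/
theorem sum_mul_le_of_mem_capacityRegion [Fintype X] (hS : IsScheduleSet S) {ε : ℝ}
    (hε : ε < 1) {C : Channel X Y} {q : Y → ℝ} {C₁ : Channel X Y}
    (hC : ∀ x y, C.matrix x y = ε * q y + (1 - ε) * C₁.matrix x y)
    (φ : EncodingPolicy N X k 0) (ψ : AllocationPolicy S Y 0) {lam : Fin N → ℝ}
    (hlam : lam ∈ capacityRegion C φ ψ) {w : Fin N → ℝ} (hw : ∀ i, 0 ≤ w i) :
    ∑ i, w i * lam i ≤ (1 - ε) * maxWeight hS w + ε * ∑ i, w i * ψ.meanService q i := by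
  by_contra! hcon
  obtain ⟨hlam, hrec⟩ := hlam
  have hwsum : 0 ≤ ∑ i, w i := Finset.sum_nonneg fun i _ => hw i
  refine (isFiniteMixture_transition C φ ψ hlam).not_isPositiveRecurrent
    (fun s => ∑ i, w i * (s.queue i : ℝ)) (B := ∑ i, w i + 1)
    (δ := ∑ i, w i * lam i -
      ((1 - ε) * maxWeight hS w + ε * ∑ i, w i * ψ.meanService q i)) (by positivity)
    (sub_pos.2 hcon) ?_ ?_ hrec
  · intro s j
    have h1 : ∑ i, w i * ((moveTarget s j).queue i : ℝ) ≤ ∑ i, w i * (s.queue i + 1 : ℝ) := by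
      refine Finset.sum_le_sum fun i _ => mul_le_mul_of_nonneg_left ?_ (hw i)
      have h2 : (j.2.2.1 i).toNat ≤ 1 := Bool.toNat_le _
      have h3 : (moveTarget s j).queue i ≤ s.queue i + 1 :=
        add_le_add (Nat.sub_le _ _) h2
      exact_mod_cast h3
    simp only [mul_add, mul_one, Finset.sum_add_distrib] at h1
    linarith
  · intro s
    have h1 : ∀ x, ∑ y, C.matrix x y * ∑ d : S, ψ.prob y d * ∑ i, w i * (d.1 i : ℝ) ≤
        (1 - ε) * maxWeight hS w + ε * ∑ i, w i * ψ.meanService q i := by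
      intro x
      rw [ψ.sum_mul_meanService]
      have h2 : ∀ y, ∑ d : S, ψ.prob y d * ∑ i, w i * (d.1 i : ℝ) ≤ maxWeight hS w := by
        intro y
        refine (Finset.sum_le_sum fun (d : S) _ => mul_le_mul_of_nonneg_left
          (le_maxWeight hS w d.2) (ψ.prob_nonneg y d.1)).trans ?_
        rw [← Finset.sum_mul, ψ.sum_prob, one_mul]
      have h3 : ∑ y, C₁.matrix x y * ∑ d : S, ψ.prob y d * ∑ i, w i * (d.1 i : ℝ) ≤
          maxWeight hS w := by
        refine (Finset.sum_le_sum fun y _ => mul_le_mul_of_nonneg_left (h2 y)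
          (C₁.nonneg x y)).trans ?_
        rw [← Finset.sum_mul, C₁.row_sum, one_mul]
      have h4 := mul_le_mul_of_nonneg_left h3 (sub_nonneg.2 hε.le)
      simp only [hC, add_mul, Finset.sum_add_distrib, mul_assoc, ← Finset.mul_sum]
      linarith
    have h5 : ∑ p, φ.prob s p * ∑ y, C.matrix p.1 y *
        ∑ d : S, ψ.prob y d * ∑ i, w i * (d.1 i : ℝ) ≤
        (1 - ε) * maxWeight hS w + ε * ∑ i, w i * ψ.meanService q i := by
      refine (Finset.sum_le_sum fun p _ => mul_le_mul_of_nonneg_left (h1 p.1)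
        (φ.prob_nonneg s p)).trans ?_
      rw [← Finset.sum_mul, φ.sum_prob, one_mul]
    have h6 := sum_moveProb_mul C φ ψ lam s (∑ i, w i * (s.queue i : ℝ)) w w
    refine le_trans ?_ (Finset.sum_le_sum fun j _ => mul_le_mul_of_nonneg_left
      (a := moveProb C φ ψ lam s j) (b := ∑ i, w i * (s.queue i : ℝ) +
        ∑ i, w i * ((j.2.2.1 i).toNat : ℝ) - ∑ i, w i * (j.2.2.2.1 i : ℝ)) ?_
      ((isFiniteMixture_transition C φ ψ hlam).nonneg s j))
    · rw [h6]
      linarith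
    · rw [← Finset.sum_add_distrib, ← Finset.sum_sub_distrib]
      refine Finset.sum_le_sum fun i _ => ?_
      rw [← mul_add, ← mul_sub]
      refine mul_le_mul_of_nonneg_left ?_ (hw i)
      -- Unused service only makes the queues larger, so truncation may be dropped in a lower bound
      -- on the drift.
      have h7 : s.queue i + (j.2.2.1 i).toNat ≤ (moveTarget s j).queue i + j.2.2.2.1 i := by
        simp only [moveTarget]
        omega
      have h8 : (s.queue i : ℝ) + (j.2.2.1 i).toNat ≤
          (moveTarget s j).queue i + j.2.2.2.1 i := by exact_mod_cast h7
      linarith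

theorem exists_mem_feasibleSet [Fintype X] (hS : IsScheduleSet S) {ε : ℝ} (hε : ε < 1)
    {C : Channel X Y} (hC : C.IsMajorizing ε)
    (φ : EncodingPolicy N X k 0) (ψ : AllocationPolicy S Y 0) {r : ℝ≥0}
    (hr : ∀ lam ∈ maxCapacityRegion S, (r : ℝ) • lam ∈ capacityRegion C φ ψ) :
    ∃ m, ((r : ℝ), m) ∈ feasibleSet hS ε := by
  obtain ⟨C₀, C₁, hmat, hrows, -⟩ := hC
  -- The encoder always emits some symbol, so `X` is inhabited and the common row of `C₀` can be
  -- named.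
  have x₀ : X := (φ.toFun 0 (fun _ => false) default default 0).1
  have hC' : ∀ x y, C.matrix x y = ε * C₀.matrix x₀ y + (1 - ε) * C₁.matrix x y := by
    intro x y
    rw [hmat, hrows x₀ x]
    rfl
  have hlim : Tendsto (fun n : ℕ => (1 - 1 / ((n : ℝ) + 2)) ^ 2) atTop (𝓝 1) := by
    have h1 : Tendsto (fun n : ℕ => 1 / ((n : ℝ) + 2)) atTop (𝓝 0) :=
      tendsto_const_nhds.div_atTop
        (tendsto_atTop_add_const_right _ _ tendsto_natCast_atTop_atTop)
    simpa using (tendsto_const_nhds (x := (1 : ℝ))).sub h1 |>.pow 2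
  have key : ∀ d ∈ S, ∀ n : ℕ, ∃ lam ∈ maxCapacityRegion S,
      ∀ i, (1 - 1 / ((n : ℝ) + 2)) ^ 2 * d i ≤ lam i := fun d hd n =>
    exists_mem_maxCapacityRegion hS hd (by positivity)
      (by rw [div_lt_one (by positivity)]; linarith [(Nat.cast_nonneg n : (0 : ℝ) ≤ n)])
  refine ⟨ψ.meanService (C₀.matrix x₀), r.2, fun d hd i => ?_,
    ψ.meanService_mem (C₀.nonneg x₀) (C₀.row_sum x₀), fun w hw => ?_⟩
  · have h1 : Tendsto (fun n : ℕ => (r : ℝ) * ((1 - 1 / ((n : ℝ) + 2)) ^ 2 * d i)) atTop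
        (𝓝 ((r : ℝ) * (1 * d i))) := (hlim.mul_const _).const_mul _
    rw [one_mul] at h1
    refine le_of_tendsto' h1 fun n => ?_
    obtain ⟨lam, hlam, hle⟩ := key d hd n
    exact (mul_le_mul_of_nonneg_left (hle i) r.2).trans ((hr lam hlam).1 i).2
  · obtain ⟨d, hd, h⟩ := exists_eq_maxWeight hS w
    have h1 : Tendsto (fun n : ℕ => (r : ℝ) * ((1 - 1 / ((n : ℝ) + 2)) ^ 2 * maxWeight hS w)) atTop
        (𝓝 ((r : ℝ) * (1 * maxWeight hS w))) := (hlim.mul_const _).const_mul _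
    rw [one_mul] at h1
    refine le_of_tendsto' h1 fun n => ?_
    obtain ⟨lam, hlam, hle⟩ := key d hd n
    refine le_trans ?_ (sum_mul_le_of_mem_capacityRegion hS hε hC' φ ψ (hr lam hlam) hw)
    simp only [Pi.smul_apply, smul_eq_mul, mul_left_comm _ (r : ℝ), ← Finset.mul_sum]
    refine mul_le_mul_of_nonneg_left ?_ r.2
    rw [← h, Finset.mul_sum]
    refine Finset.sum_le_sum fun i _ => ?_
    rw [mul_left_comm]
    exact mul_le_mul_of_nonneg_left (hle i) (hw i)

theorem capacityFactor_le [Fintype X] (hS : IsScheduleSet S) {ε : ℝ} (hε : ε < 1)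
    {C : Channel X Y} (hC : C.IsMajorizing ε) {ρ : ℝ≥0}
    (hρ : ∀ p ∈ feasibleSet hS ε, p.1 ≤ ρ) (k : ℕ) : capacityFactor S C k 0 ≤ ρ := by
  refine iSup₂_le fun φ ψ => iSup₂_le fun r hr => ?_
  obtain ⟨m, hm⟩ := exists_mem_feasibleSet hS hε hC φ ψ hr
  exact_mod_cast hρ _ hm

/-- An encoding policy that ignores an additional bit of memory and resets it. -/
def EncodingPolicy.addBit {v : ℕ} (φ : EncodingPolicy N X k v) : EncodingPolicy N X (k + 1) v where
  toFun q a m r u :=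
    ((φ.toFun q a (Fin.tail m) r u).1, Fin.cons false (φ.toFun q a (Fin.tail m) r u).2)
  measurable q a m r p := by
    by_cases hp : p.2 0 = false
    · convert φ.measurable q a (Fin.tail m) r (p.1, Fin.tail p.2) using 3 with u
      constructor
      · rintro rfl
        simp
      · intro h
        rw [h]
        refine Prod.ext rfl ?_
        simp only [← hp]
        exact Fin.cons_self_tail p.2
    · convert MeasurableSet.empty using 1
      refine Set.eq_empty_of_forall_notMem fun u hu => hp ?_
      rw [← show _ = p from hu]
      rfl

/-- After one step the extra bit is `false` for good, and deleting it recovers the original chain.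
This makes the capacity factor monotone in `k`, whence the limit. -/
theorem capacityRegion_subset_addBit {v : ℕ} (C : Channel X Y) (φ : EncodingPolicy N X k v)
    (ψ : AllocationPolicy S Y v) : capacityRegion C φ ψ ⊆ capacityRegion C φ.addBit ψ := by
  rintro lam ⟨hlam, hrec⟩
  refine ⟨hlam, hrec.lift
    (fun s => ⟨s.queue, s.arrival, Fin.tail s.encMem, s.signal, s.message, s.recMem⟩)
    (fun s => ⟨s.queue, s.arrival, Fin.cons false s.encMem, s.signal, s.message, s.recMem⟩)
    (fun s => by simp only [Fin.tail_cons]) (fun s' s => ?_) (fun s' t' h => ?_)⟩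
  · simp only [transition, EncodingPolicy.addBit, Prod.ext_iff, Fin.cons_inj, true_and]
  · have h1 : {u : unitInterval | φ.addBit.toFun s'.queue s'.arrival s'.encMem s'.recMem u =
        (t'.signal, t'.encMem)} = ∅ := by
      refine Set.eq_empty_of_forall_notMem fun u hu => h ?_
      have h2 := congrArg Prod.snd (show _ = (t'.signal, t'.encMem) from hu)
      obtain ⟨q, a, m, x, y, r⟩ := t'
      simp only [EncodingPolicy.addBit] at h2
      simp only [← h2, Fin.tail_cons]
    rw [transition, h1, measure_empty]
    simp

theorem monotone_capacityFactor (S : Finset (Fin N → ℕ)) (C : Channel X Y) (v : ℕ) :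
    Monotone fun k => capacityFactor S C k v := by
  refine monotone_nat_of_le_succ fun k => iSup₂_le fun φ ψ => iSup₂_le fun r hr => ?_
  refine le_trans ?_ (le_iSup₂ (f := fun (φ : EncodingPolicy N X (k + 1) v)
    (ψ : AllocationPolicy S Y v) => policyCapacityFactor C φ ψ) φ.addBit ψ)
  exact le_iSup₂ (f := fun (r : ℝ≥0) (_ : ∀ lam ∈ maxCapacityRegion S,
    (r : ℝ) • lam ∈ capacityRegion C φ.addBit ψ) => (r : ℝ≥0∞)) r
    fun lam hlam => capacityRegion_subset_addBit C φ ψ (hr lam hlam)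

end

end

/-! ### Achievability by max-weight over the replacement channel -/

section

variable {N : ℕ} {S : Finset (Fin N → ℕ)}

theorem exists_weights_of_mem_scheduleHull {m : Fin N → ℝ} (hm : m ∈ scheduleHull S) :
    ∃ W : S → ℝ, (∀ d, 0 ≤ W d) ∧ ∑ d, W d = 1 ∧ ∀ i, ∑ d : S, W d * (d.1 i : ℝ) = m i := by
  classical
  have hinj : Function.Injective (fun (d : Fin N → ℕ) (i : Fin N) => (d i : ℝ)) := fun d d' h =>
    funext fun i => Nat.cast_injective (congrFun h i)
  rw [scheduleHull, ← Finset.coe_image, Finset.mem_convexHull'] at hm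
  obtain ⟨W, h0, h1, h2⟩ := hm
  rw [Finset.sum_image hinj.injOn] at h1 h2
  refine ⟨fun d => W fun i => (d.1 i : ℝ), fun d => h0 _ (Finset.mem_image_of_mem _ d.2), ?_,
    fun i => ?_⟩
  · exact (Finset.sum_coe_sort S fun d => W fun i => (d i : ℝ)).trans h1
  · rw [← h2, Finset.sum_apply]
    exact Finset.sum_coe_sort S fun d => (W fun i => (d i : ℝ)) * (d i : ℝ)

/-- The channel that transmits the schedule faithfully with probability `1 - ε` and otherwise
replaces it by a random schedule of law `W`. -/
noncomputable def replacementChannel {ε : ℝ} (h0 : 0 ≤ ε) (h1 : ε ≤ 1) (W : S → ℝ)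
    (hW : ∀ d, 0 ≤ W d) (hW1 : ∑ d, W d = 1) : Channel S S where
  matrix x y := ε * W y + (1 - ε) * if y = x then 1 else 0
  nonneg x y := by
    have := mul_nonneg h0 (hW y)
    have : 0 ≤ 1 - ε := sub_nonneg.2 h1
    split_ifs <;> linarith
  row_sum x := by
    rw [Finset.sum_add_distrib, ← Finset.mul_sum, ← Finset.mul_sum, hW1, Finset.sum_ite_eq',
      if_pos (Finset.mem_univ _)]
    ring

theorem isMajorizing_replacementChannel (hS : IsScheduleSet S) {ε : ℝ} (h0 : 0 ≤ ε) (h1 : ε ≤ 1)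
    (W : S → ℝ) (hW : ∀ d, 0 ≤ W d) (hW1 : ∑ d, W d = 1) :
    (replacementChannel h0 h1 W hW hW1).IsMajorizing ε := by
  refine ⟨⟨fun _ y => W y, fun _ => hW, fun _ => hW1⟩,
    ⟨fun x y => if y = x then 1 else 0, fun x y => by positivity, fun x => by simp⟩,
    rfl, fun _ _ _ => rfl, fun y => ?_⟩
  -- Two distinct schedules suffice for every column of the identity matrix to contain a zero.
  obtain ⟨d₁, d₂, hne, hd₁, hd₂⟩ := hS.two_maximal
  by_cases h : y = ⟨d₁, hd₁.prop⟩
  · refine ⟨⟨d₂, hd₂.prop⟩, if_neg fun h' => hne ?_⟩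
    simpa using h.symm.trans h'
  · exact ⟨⟨d₁, hd₁.prop⟩, if_neg h⟩

/-- The receiver that allocates the schedule it is told. -/
def obeyMessage (S : Finset (Fin N → ℕ)) : AllocationPolicy S S 0 where
  allocate y _ _ := y
  update _ _ _ := default
  allocate_mem y _ _ := y.2
  measurable_allocate _ _ _ := MeasurableSet.const _
  measurable_update _ _ _ := MeasurableSet.const _

theorem prob_obeyMessage (y d : S) : (obeyMessage S).prob y d = if d = y then 1 else 0 := by
  rw [AllocationPolicy.prob]
  split_ifs with h
  · subst h
    simp [obeyMessage]
  · have : {u : unitInterval | (obeyMessage S).allocate y default u = d} = ∅ :=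
      Set.eq_empty_of_forall_notMem fun u hu => h (Subtype.ext hu).symm
    rw [this, measureReal_empty]

/-- A memoryless deterministic encoder. -/
def memorylessEncoder {X : Type} (g : (Fin N → ℕ) → X) : EncodingPolicy N X 0 0 where
  toFun q _ _ _ _ := (g q, default)
  measurable _ _ _ _ _ := MeasurableSet.const _

theorem prob_memorylessEncoder {X Y : Type} [DecidableEq X] (g : (Fin N → ℕ) → X)
    (w : State N X Y 0 0) (p : X × Memory 0) :
    (memorylessEncoder g).prob w p = if p = (g w.queue, default) then 1 else 0 := by
  rw [EncodingPolicy.prob]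
  split_ifs with h
  · subst h
    simp [memorylessEncoder]
  · have : {u : unitInterval | (memorylessEncoder g).toFun w.queue w.arrival w.encMem w.recMem u =
        p} = ∅ := Set.eq_empty_of_forall_notMem fun u hu => h (Eq.symm hu)
    rw [this, measureReal_empty]

/-- Each squared queue changes by at most a linear drift and a constant. -/
theorem sq_queue_le (q d : ℕ) (a : Bool) {D : ℕ} (hd : d ≤ D) :
    ((q - d + a.toNat : ℕ) : ℝ) ^ 2 ≤
      (q : ℝ) ^ 2 + ((D : ℝ) ^ 2 + 1) + 2 * q * a.toNat - 2 * q * d := by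
  have hdD : (d : ℝ) ≤ D := by exact_mod_cast hd
  have hd0 : (0 : ℝ) ≤ d := Nat.cast_nonneg _
  have hq0 : (0 : ℝ) ≤ q := Nat.cast_nonneg _
  have hsq : (d : ℝ) ^ 2 ≤ D ^ 2 := by gcongr
  push_cast
  -- Truncation does not increase the square, and the cross term with the arrival needs only `q - d
  -- ≤ q`.
  have hx : ((q - d : ℕ) : ℝ) ^ 2 ≤ ((q : ℝ) - d) ^ 2 := by
    rcases le_total d q with h | h
    · rw [Nat.cast_sub h]
    · rw [Nat.sub_eq_zero_of_le h]
      simpa using sq_nonneg ((q : ℝ) - d)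
  have hx' : ((q - d : ℕ) : ℝ) ≤ q := by exact_mod_cast Nat.sub_le _ _
  cases a
  · simp only [Bool.toNat_false, Nat.cast_zero]
    linarith
  · simp only [Bool.toNat_true, Nat.cast_one]
    linarith

/-- Max-weight scheduling over the replacement channel stabilizes the feasible fraction of the
maximum capacity region. -/
theorem smul_mem_capacityRegion (hS : IsScheduleSet S) {ε : ℝ} (h0 : 0 ≤ ε) (h1 : ε < 1)
    (W : S → ℝ) (hW : ∀ d, 0 ≤ W d) (hW1 : ∑ d, W d = 1) {p : ℝ × (Fin N → ℝ)}
    (hp : p ∈ feasibleSet hS ε) (hp0 : 0 < p.1) (hWm : ∀ i, ∑ d : S, W d * (d.1 i : ℝ) = p.2 i)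
    (g : (Fin N → ℕ) → S)
    (hg : ∀ q : Fin N → ℕ, ∑ i, (2 * (q i : ℝ)) * ((g q).1 i : ℝ) =
      maxWeight hS fun i => 2 * (q i : ℝ))
    {lam : Fin N → ℝ} (hlam : lam ∈ maxCapacityRegion S) :
    p.1 • lam ∈ capacityRegion (replacementChannel h0 h1.le W hW hW1) (memorylessEncoder g)
      (obeyMessage S) := by
  obtain ⟨hlam0, z, hz, hlamz⟩ := hlam
  obtain ⟨-, hp1, -, hpw⟩ := hp
  have hlt : ∀ i, (p.1 • lam) i < 1 := by
    intro i
    obtain ⟨d, hd, hzd⟩ := exists_le_of_mem_scheduleHull hS hz i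
    calc p.1 * lam i < p.1 * d i := mul_lt_mul_of_pos_left ((hlamz i).trans_le hzd) hp0
      _ ≤ 1 := hp1 d hd i
  have hrange : ∀ i, 0 ≤ (p.1 • lam) i ∧ (p.1 • lam) i ≤ 1 := fun i =>
    ⟨mul_nonneg hp0.le (hlam0 i), (hlt i).le⟩
  refine ⟨hrange, ?_⟩
  -- A slack uniform over the coordinates; it produces the drift term `-2 * p.1 * γ * ∑ i, q i`.
  obtain ⟨γ, hγ, hγ0⟩ : ∃ γ : ℝ, (∀ i, lam i + γ < z i) ∧ 0 < γ := by
    have h2 : ∀ᶠ γ in 𝓝[>] (0 : ℝ), ∀ i, lam i + γ < z i := by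
      refine eventually_all.2 fun i => ?_
      have : ∀ᶠ γ in 𝓝[>] (0 : ℝ), γ < z i - lam i :=
        nhdsWithin_le_nhds (eventually_lt_nhds (sub_pos.2 (hlamz i)))
      filter_upwards [this] with γ hγ
      linarith
    exact (h2.and self_mem_nhdsWithin).exists
  obtain ⟨D, hD⟩ : ∃ D : ℕ, ∀ d ∈ S, ∀ i, d i ≤ D :=
    ⟨S.sup fun d => ∑ i, d i, fun d hd i =>
      (Finset.single_le_sum (f := d) (fun _ _ => Nat.zero_le _) (Finset.mem_univ i)).trans
        (Finset.le_sup (f := fun d : Fin N → ℕ => ∑ i, d i) hd)⟩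
  set C := replacementChannel h0 h1.le W hW hW1 with hC
  have hmix := isFiniteMixture_transition C (memorylessEncoder g) (obeyMessage S) hrange
  have hppos : 0 < (1 - ε) * arrivalWeight (p.1 • lam) fun _ => false := by
    refine mul_pos (sub_pos.2 h1) (Finset.prod_pos fun i _ => ?_)
    simpa using hlt i
  refine hmix.isPositiveRecurrent ⟨0, fun _ => false, default, g 0, g 0, default⟩
    (fun s => ∑ i, (s.queue i : ℝ) ^ 2) (fun s => ∑ i, s.queue i)
    (b := ∑ _i : Fin N, ((D : ℝ) ^ 2 + 1)) (θ := 2 * p.1 * γ) (by positivity) (by positivity)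
    hppos (fun s => by positivity) ?_ ?_
  · intro s
    have h2 := sum_moveProb_mul C (memorylessEncoder g) (obeyMessage S) (p.1 • lam) s
      (∑ i, ((s.queue i : ℝ) ^ 2 + ((D : ℝ) ^ 2 + 1))) (fun i => 2 * (s.queue i : ℝ))
      (fun i => 2 * (s.queue i : ℝ))
    have h3 : ∑ q, (memorylessEncoder g).prob s q * ∑ y, C.matrix q.1 y *
        ∑ d : S, (obeyMessage S).prob y d * ∑ i, 2 * (s.queue i : ℝ) * (d.1 i : ℝ) =
        (1 - ε) * maxWeight hS (fun i => 2 * (s.queue i : ℝ)) +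
          ε * ∑ i, 2 * (s.queue i : ℝ) * p.2 i := by
      simp only [prob_memorylessEncoder, prob_obeyMessage, ite_mul, one_mul, zero_mul,
        Finset.sum_ite_eq', Finset.mem_univ, if_true, hC, replacementChannel, add_mul,
        Finset.sum_add_distrib, mul_assoc (1 - ε), mul_assoc ε, ← Finset.mul_sum]
      rw [hg, add_comm]
      congr 2
      simp only [← hWm, Finset.mul_sum]
      rw [Finset.sum_comm]
      exact Finset.sum_congr rfl fun i _ => Finset.sum_congr rfl fun d _ => by ring
    have h4 := hpw (fun i => 2 * (s.queue i : ℝ)) fun i => by positivity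
    have h5 : ∑ i, 2 * (s.queue i : ℝ) * (lam i + γ) ≤
        maxWeight hS fun i => 2 * (s.queue i : ℝ) :=
      (Finset.sum_le_sum fun i _ => mul_le_mul_of_nonneg_left (hγ i).le (by positivity)).trans
        (sum_mul_le_maxWeight hS _ hz)
    have h6 := mul_le_mul_of_nonneg_left h5 hp0.le
    have h7 : p.1 * ∑ i, 2 * (s.queue i : ℝ) * (lam i + γ) =
        ∑ i, 2 * (s.queue i : ℝ) * (p.1 • lam) i + 2 * p.1 * γ * ∑ i, (s.queue i : ℝ) := by
      rw [Finset.mul_sum, Finset.mul_sum, ← Finset.sum_add_distrib]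
      refine Finset.sum_congr rfl fun i _ => ?_
      rw [Pi.smul_apply, smul_eq_mul]
      ring
    have h8 : ∑ j, moveProb C (memorylessEncoder g) (obeyMessage S) (p.1 • lam) s j *
        ∑ i, ((moveTarget s j).queue i : ℝ) ^ 2 ≤
        ∑ j : (S × Memory 0) × S × (Fin N → Bool) × S,
          moveProb C (memorylessEncoder g) (obeyMessage S) (p.1 • lam) s j *
          (∑ i, ((s.queue i : ℝ) ^ 2 + ((D : ℝ) ^ 2 + 1)) +
            ∑ i, 2 * (s.queue i : ℝ) * ((j.2.2.1 i).toNat : ℝ) -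
            ∑ i, 2 * (s.queue i : ℝ) * (j.2.2.2.1 i : ℝ)) := by
      refine Finset.sum_le_sum fun j _ => mul_le_mul_of_nonneg_left ?_ (hmix.nonneg s j)
      rw [← Finset.sum_add_distrib, ← Finset.sum_sub_distrib]
      exact Finset.sum_le_sum fun i _ => sq_queue_le _ _ _ (hD _ j.2.2.2.2 i)
    rw [h2, h3] at h8
    rw [Finset.sum_add_distrib] at h8
    push_cast
    linarith
  · intro s
    -- The favourable move is faithful transmission with no arrivals, possible since all rates are
    -- below one. It keeps an empty system empty. Otherwise the max-weight schedule has positive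
    -- weight, so it serves some nonempty queue.
    refine ⟨((g s.queue, default), g s.queue, fun _ => false, g s.queue), ?_, ?_⟩
    · rw [moveProb, prob_memorylessEncoder, prob_obeyMessage, if_pos rfl, if_pos rfl, one_mul,
        mul_one]
      refine mul_le_mul_of_nonneg_right ?_ (arrivalWeight_nonneg hrange _)
      simp only [hC, replacementChannel, if_true]
      linarith [mul_nonneg h0 (hW (g s.queue))]
    · by_cases hq : s.queue = 0
      · left
        rw [moveTarget]
        simp only [hq, State.mk.injEq, and_true]
        funext i
        simp
      · right
        obtain ⟨i, hi⟩ := Function.ne_iff.1 hq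
        have hi' : 0 < s.queue i := Nat.pos_of_ne_zero hi
        obtain ⟨c, hc, hcS⟩ := hS.serves_each
        have h2 : 0 < ∑ i, (2 * (s.queue i : ℝ)) * ((g s.queue).1 i : ℝ) := by
          rw [hg]
          refine lt_of_lt_of_le ?_ (le_maxWeight hS _ (hcS i))
          refine Finset.sum_pos' (fun j _ => by positivity) ⟨i, Finset.mem_univ _, ?_⟩
          rw [Pi.single_eq_same]
          positivity
        obtain ⟨j, -, hj⟩ := Finset.exists_lt_of_sum_lt
          (f := fun _ => (0 : ℝ)) (by simpa using h2)
        have hj1 : s.queue j ≠ 0 := fun h => by simp [h] at hj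
        have hj2 : (g s.queue).1 j ≠ 0 := fun h => by simp [h] at hj
        refine Finset.sum_lt_sum (fun i _ => ?_) ⟨j, Finset.mem_univ _, ?_⟩
        · simp [moveTarget]
        · simp only [moveTarget, Bool.toNat_false, add_zero]
          omega

end

end SPII

theorem mainTheorem2 {N : ℕ} (S : Finset (Fin N → ℕ)) (hS : SPII.IsScheduleSet S)
    (ε : ℝ) (hε₀ : 0 < ε) (hε₁ : ε < 1) :
    ∃ ρ : ℝ≥0, ρ < 1 ∧
      (∀ (X Y : Type) [Fintype X] [Fintype Y] (C : SPII.Channel X Y), C.IsMajorizing ε →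
        (∀ k : ℕ, SPII.capacityFactor S C k 0 ≤ ρ) ∧
        ∃ L : ℝ≥0∞, Tendsto (fun k : ℕ => SPII.capacityFactor S C k 0) atTop (𝓝 L) ∧ L ≤ ρ) ∧
      (∃ (X Y : Type) (_ : Fintype X) (_ : Fintype Y) (C : SPII.Channel X Y),
        C.IsMajorizing ε ∧ SPII.capacityFactor S C 0 0 = ρ) := by
  obtain ⟨⟨ρ, m⟩, hp, hmax⟩ := SPII.exists_isMaxOn_feasibleSet hS hε₀ hε₁
  lift ρ to ℝ≥0 using hp.1
  refine ⟨ρ, SPII.lt_one_of_mem_feasibleSet hS hε₀ hp, fun X Y _ _ C hC => ?_, ?_⟩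
  · have hle := SPII.capacityFactor_le hS hε₁ hC hmax
    exact ⟨hle, _, tendsto_atTop_iSup (SPII.monotone_capacityFactor S C 0), iSup_le hle⟩
  · obtain ⟨W, hW, hW1, hWm⟩ := SPII.exists_weights_of_mem_scheduleHull hp.2.2.1
    have hmaj := SPII.isMajorizing_replacementChannel hS hε₀.le hε₁.le W hW hW1
    refine ⟨S, S, inferInstance, inferInstance, _, hmaj,
      le_antisymm (SPII.capacityFactor_le hS hε₁ hmaj hmax 0) ?_⟩
    rcases eq_zero_or_pos ρ with rfl | hρ
    · simp
    · choose g hgS hg using fun q : Fin N → ℕ =>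
        SPII.exists_eq_maxWeight hS fun i => 2 * (q i : ℝ)
      refine le_trans ?_ (le_iSup₂ (f := fun (φ : SPII.EncodingPolicy N S 0 0)
        (ψ : SPII.AllocationPolicy S S 0) => SPII.policyCapacityFactor _ φ ψ)
        (SPII.memorylessEncoder fun q => ⟨g q, hgS q⟩) (SPII.obeyMessage S))
      exact le_iSup₂_of_le ρ
        (fun lam hlam => SPII.smul_mem_capacityRegion hS hε₀.le hε₁ W hW hW1 hp hρ hWm
          (fun q => ⟨g q, hgS q⟩) hg hlam) le_rfl
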